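/- Let $X$ be a complex Banach space represented as the direct sum $X=X_1\oplus X_2\oplus\dots\oplus X_n$ of closed nonzero subspaces. A bounded linear operator $T$ on $X$ is identified with its operator matrix $\{T_{ij}\}$, where $T_{ij}:X_j\to X_i$ is bounded. Let $\mathcal M^+$ be the closed unital subalgebra of lower triangular matrices ($T_{ij}=0$ for $i<j$). The causal spectrum $\sigma^+(A)$ of $A\in\mathcal M^+$ is the spectrum of $A$ in the algebra $\mathcal M^+$; it contains the ordinary spectrum $\sigma(A)$ of $A$ in the algebra of all bounded operators on $X$. A contour is a finite family of oriented $C^1$ arcs in $\mathbb C$ such that every point is the initial point of as many arcs as it is the terminal point of. A contour $\Gamma$ surrounds a compact set $K$ in an open set $U\supseteq K$ if $\Gamma$ lies in $U\setminus K$, its winding number about every point of $K$ is $1$, and its winding number about every point of $\mathbb C\setminus U$ is $0$. For $f$ analytic in an open set $U\supseteq\sigma(A)$, the operator $$f(A)=\frac1{2\pi i}\int_{\Gamma}f(\lambda)(\lambda\mathbf 1-A)^{-1}\,d\lambda$$ is defined by means of an arbitrary contour $\Gamma$ surrounding $\sigma(A)$ in $U$. Let $A\in\mathcal M^+$ and let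 $f$ be analytic in an open set $U\supseteq\sigma^+(A)$. Then the matrix $F=f(A)$ is lower triangular, i.e. $F_{ij}=0$ for $i<j$. Moreover, let $\Gamma$ be any contour surrounding $\sigma^+(A)$ in $U$. Then all the operators $\lambda\mathbf1-A_{ii}$, $\lambda\in\Gamma$, are invertible, and for all $i\ge j$ the integrals below exist and $$F_{ij}=\sum_{i=i_1>i_2>\dots>i_m=j}\frac1{2\pi i}\int_\Gamma f(\lambda)(\lambda\mathbf1-A_{i_1i_1})^{-1}A_{i_1i_2}(\lambda\mathbf1-A_{i_2i_2})^{-1}A_{i_2i_3}\cdots A_{i_{m-1}i_m}(\lambda\mathbf1-A_{i_mi_m})^{-1}\,d\lambda ,$$ where the sum is over all strictly decreasing chains of indices of any length $m\ge1$ from $i$ to $j$. In particular, $$F_{ii}=\frac1{2\pi i}\int_\Gamma f(\lambda)(\lambda\mathbf1-A_{ii})^{-1}\,d\lambda,$$ $$F_{i+1,i}=\frac1{2\pi i}\int_\Gamma f(\lambda)(\lambda\mathbf1-A_{i+1,i+1})^{-1}A_{i+1,i}(\lambda\mathbf1-A_{ii})^{-1}\,d\lambda,$$ $$F_{i+2,i}=\frac1{2\pi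 i}\int_\Gamma f(\lambda)(\lambda\mathbf1-A_{i+2,i+2})^{-1}A_{i+2,i}(\lambda\mathbf1-A_{ii})^{-1}\,d\lambda$$ $$\qquad+\frac1{2\pi i}\int_\Gamma f(\lambda)(\lambda\mathbf1-A_{i+2,i+2})^{-1}A_{i+2,i+1}(\lambda\mathbf1-A_{i+1,i+1})^{-1}A_{i+1,i}(\lambda\mathbf1-A_{ii})^{-1}\,d\lambda.$$ -/

import Mathlib

open scoped BigOperators

noncomputable section

/-! ### Contours in the complex plane -/

/-- A contour: a finite family of oriented `C¹` arcs in the complex plane which is a cycle, i.e.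
every point of the plane is the initial point of as many arcs as it is the terminal point of.
In particular, a finite family of closed piecewise `C¹` curves is a contour. -/
structure Contour where
  /-- the number of arcs -/
  n : ℕ
  /-- the initial points of the arcs -/
  src : Fin n → ℂ
  /-- the terminal points of the arcs -/
  tgt : Fin n → ℂ
  /-- the arcs -/
  arc : ∀ k, Path (src k) (tgt k)
  contDiffOn : ∀ k, ContDiffOn ℝ 1 (arc k).extend (Set.Icc 0 1)
  closed : (Finset.univ : Finset (Fin n)).val.map src = (Finset.univ : Finset (Fin n)).val.map tgt

namespace Contour

variable {F : Type*} [NormedAddCommGroup F] [NormedSpace ℂ F]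

/-- The set of points through which the contour passes. -/
def support (Γ : Contour) : Set ℂ := ⋃ k, Set.range (Γ.arc k)

/-- The differential form `g(λ) dλ`. -/
def form (g : ℂ → F) (z : ℂ) : ℂ →L[ℂ] F := ContinuousLinearMap.toSpanSingleton ℂ (g z)

/-- `g(λ) dλ` is integrable along the contour. -/
def Integrable (Γ : Contour) (g : ℂ → F) : Prop :=
  ∀ k, CurveIntegrable (form g) (Γ.arc k)

/-- The contour integral `∫_Γ g(λ) dλ`. -/
def integral (Γ : Contour) (g : ℂ → F) : F :=
  ∑ k, curveIntegral (form g) (Γ.arc k)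

/-- The normalized contour integral `(2πi)⁻¹ ∫_Γ g(λ) dλ`. -/
def normIntegral (Γ : Contour) (g : ℂ → F) : F :=
  (2 * (Real.pi : ℂ) * Complex.I)⁻¹ • Γ.integral g

/-- The index (winding number) of the contour with respect to a point `w` outside of it. -/
def index (Γ : Contour) (w : ℂ) : ℂ := Γ.normIntegral fun z => (z - w)⁻¹

/-- The contour `Γ` surrounds the set `K` in `U` in the counterclockwise direction: it lies in
`U \ K`, winds once around every point of `K`, and does not wind around any point outside `U`
(so that everything inside `Γ` belongs to `U`). -/
structure Surrounds (Γ : Contour) (K U : Set ℂ) : Prop where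
  support_subset : Γ.support ⊆ U \ K
  index_eq_one : ∀ w ∈ K, Γ.index w = 1
  index_eq_zero : ∀ w, w ∉ U → Γ.index w = 0

end Contour

/-! ### Analytic functions of an element of a Banach algebra -/

open Classical in
/-- The function `f(a) = (2πi)⁻¹ ∫_Γ f(λ) (λ1 - a)⁻¹ dλ` of an element `a` of a unital Banach
algebra, where `f` is analytic in an open set `U` that contains the spectrum of `a`, and `Γ` is a
contour surrounding the spectrum of `a` in `U`. -/
def analyticFun {B : Type*} [NormedRing B] [NormedAlgebra ℂ B] (U : Set ℂ) (f : ℂ → ℂ) (a : B) :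
    B :=
  if h : ∃ Γ : Contour, Γ.Surrounds (spectrum ℂ a) U then
    h.choose.normIntegral fun z => f z • resolvent a z
  else 0

/-! ### Direct sums of closed subspaces and operator matrices -/

/-- A representation `X = X₁ ⊕ ⋯ ⊕ Xₙ` of `X` as the direct sum of closed nonzero subspaces. -/
structure ClosedDirectSum (X : Type*) [NormedAddCommGroup X] [NormedSpace ℂ X] (n : ℕ) where
  /-- the summands -/
  V : Fin n → Submodule ℂ X
  isClosed : ∀ i, IsClosed (V i : Set X)
  ne_bot : ∀ i, V i ≠ ⊥
  existsUnique : ∀ x : X, ∃! y : (∀ i, V i), ∑ i, (y i : X) = x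

namespace ClosedDirectSum

variable {X : Type*} [NormedAddCommGroup X] [NormedSpace ℂ X] {n : ℕ}

/-- The summation map `(x₁, …, xₙ) ↦ x₁ + ⋯ + xₙ`. -/
def sumMap (D : ClosedDirectSum X n) : (∀ i, D.V i) →L[ℂ] X :=
  ∑ i, (D.V i).subtypeL ∘L ContinuousLinearMap.proj i

theorem sumMap_apply (D : ClosedDirectSum X n) (y : ∀ i, D.V i) :
    D.sumMap y = ∑ i, (y i : X) := by
  simp [sumMap]

variable [CompleteSpace X]

instance (D : ClosedDirectSum X n) (i : Fin n) : CompleteSpace (D.V i) :=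
  (D.isClosed i).completeSpace_coe

/-- The summation map is an isomorphism of Banach spaces. -/
def sumEquiv (D : ClosedDirectSum X n) : (∀ i, D.V i) ≃L[ℂ] X :=
  ContinuousLinearEquiv.ofBijective D.sumMap
    (LinearMap.ker_eq_bot.mpr fun y z h => by
      obtain ⟨w, -, hw⟩ := D.existsUnique (D.sumMap z)
      rw [hw y ((D.sumMap_apply y).symm.trans h), hw z (D.sumMap_apply z).symm])
    (LinearMap.range_eq_top.mpr fun x => by
      obtain ⟨w, hw, -⟩ := D.existsUnique x
      exact ⟨w, (D.sumMap_apply w).trans hw⟩)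

theorem sumEquiv_apply (D : ClosedDirectSum X n) (y : ∀ i, D.V i) :
    D.sumEquiv y = ∑ i, (y i : X) := D.sumMap_apply y

/-- The map that takes `x` to its component `xᵢ`. -/
def component (D : ClosedDirectSum X n) (i : Fin n) : X →L[ℂ] D.V i :=
  ContinuousLinearMap.proj i ∘L (D.sumEquiv.symm : X →L[ℂ] ∀ i, D.V i)

theorem sum_component (D : ClosedDirectSum X n) (x : X) : ∑ i, (D.component i x : X) = x := by
  have h := D.sumEquiv.apply_symm_apply x
  rwa [sumEquiv_apply] at h

theorem component_coe (D : ClosedDirectSum X n) (i j : Fin n) (y : D.V j) (h : i ≠ j) :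
    D.component i (y : X) = 0 := by
  have hs : D.sumEquiv (Pi.single j y) = (y : X) := by
    rw [sumEquiv_apply, Finset.sum_eq_single j]
    · simp
    · intro k _ hk
      simp [Pi.single_eq_of_ne hk]
    · simp
  have : D.sumEquiv.symm (y : X) = Pi.single j y := by rw [← hs, D.sumEquiv.symm_apply_apply]
  change (D.sumEquiv.symm (y : X)) i = 0
  rw [this, Pi.single_eq_of_ne h]

/-- The entry `Aᵢⱼ : Xⱼ → Xᵢ` of the operator matrix that induces the operator `A`. -/
def block (D : ClosedDirectSum X n) (A : X →L[ℂ] X) (i j : Fin n) : D.V j →L[ℂ] D.V i :=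
  D.component i ∘L A ∘L (D.V j).subtypeL

theorem block_mul (D : ClosedDirectSum X n) (A B : X →L[ℂ] X) (i j : Fin n) :
    D.block (A * B) i j = ∑ k, D.block A i k ∘L D.block B k j := by
  ext1 y
  simp only [block, sum_apply, ContinuousLinearMap.comp_apply,
    mul_apply_eq_comp, Submodule.subtypeL_apply]
  conv_lhs => rw [← D.sum_component (B y)]
  simp only [map_sum]

/-- The algebra of causal operators, i.e. those induced by lower triangular matrices. -/
def causal (D : ClosedDirectSum X n) : Subalgebra ℂ (X →L[ℂ] X) where
  carrier := {A | ∀ i j, i < j → D.block A i j = 0}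
  mul_mem' {A B} hA hB i j hij := by
    rw [block_mul]
    refine Finset.sum_eq_zero fun k _ => ?_
    rcases lt_or_ge i k with h | h
    · rw [hA i k h, ContinuousLinearMap.zero_comp]
    · rw [hB k j (h.trans_lt hij), ContinuousLinearMap.comp_zero]
  add_mem' {A B} hA hB i j hij := by
    have : D.block (A + B) i j = D.block A i j + D.block B i j := by
      ext1 y; simp [block]
    rw [this, hA i j hij, hB i j hij, add_zero]
  algebraMap_mem' r i j hij := by
    ext1 y
    simp [block, Algebra.algebraMap_eq_smul_one, D.component_coe i j y hij.ne]

/-- The causal spectrum: the spectrum of a causal operator in the algebra of causal operators. -/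
def causalSpectrum (D : ClosedDirectSum X n) (A : D.causal) : Set ℂ := spectrum ℂ A

/-- The ordinary resolvent `(λ1 - Aᵢᵢ)⁻¹` of the diagonal block `Aᵢᵢ`. -/
def blockResolvent (D : ClosedDirectSum X n) (A : X →L[ℂ] X) (i : Fin n) (z : ℂ) :
    D.V i →L[ℂ] D.V i :=
  resolvent (D.block A i i) z

end ClosedDirectSum

/-! ### Decreasing chains of indices -/

/-- The chains `i = i₁ > i₂ > ⋯ > iₘ = j`, `m ≥ 1`. -/
inductive Chain {n : ℕ} : Fin n → Fin n → Type
  | single (i : Fin n) : Chain i i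
  | cons {i k j : Fin n} (h : k < i) (c : Chain k j) : Chain i j

namespace Chain

instance {n : ℕ} (i j : Fin n) : Finite (Chain i j) := by
  induction i using WellFoundedLT.induction with
  | ind i ih =>
    have (k : {k : Fin n // k < i}) : Finite (Chain k.1 j) := ih k.1 k.2
    refine Finite.of_surjective
      (fun s : PLift (i = j) ⊕ (Σ k : {k : Fin n // k < i}, Chain k.1 j) =>
        match s with
        | .inl h => h.down ▸ Chain.single i
        | .inr p => Chain.cons p.1.2 p.2) ?_
    intro c
    cases c with
    | single => exact ⟨.inl ⟨rfl⟩, rfl⟩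
    | cons h c => exact ⟨.inr ⟨⟨_, h⟩, c⟩, rfl⟩

instance {n : ℕ} (i j : Fin n) : Fintype (Chain i j) := Fintype.ofFinite _

variable {X : Type*} [NormedAddCommGroup X] [NormedSpace ℂ X] [CompleteSpace X] {n : ℕ}

/-- The product
`(λ1 - A_{i₁i₁})⁻¹ A_{i₁i₂} (λ1 - A_{i₂i₂})⁻¹ A_{i₂i₃} ⋯ A_{iₘ₋₁iₘ} (λ1 - A_{iₘiₘ})⁻¹`
along the chain `i = i₁ > i₂ > ⋯ > iₘ = j`. -/
def resolventProd (D : ClosedDirectSum X n) (A : X →L[ℂ] X) (z : ℂ) :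
    {i j : Fin n} → Chain i j → (D.V j →L[ℂ] D.V i)
  | i, _, .single _ => D.blockResolvent A i z
  | i, _, .cons (k := k) _ c => D.blockResolvent A i z ∘L D.block A i k ∘L c.resolventProd D A z

end Chain

end

/-!
Off the causal spectrum the resolvent `R = (z - A)⁻¹` is lower triangular, so the diagonal entries
of `(z - A) R = R (z - A) = 1` say that every `z - Aᵢᵢ` is invertible, and forward substitution in
`(z - A) R = 1` gives the recursion
`Rᵢⱼ = (z - Aᵢᵢ)⁻¹ (δᵢⱼ + ∑_{k < i} Aᵢₖ Rₖⱼ)` (`ClosedDirectSum.block_resolvent`). The sums over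
decreasing chains satisfy the same recursion (`Chain.block_resolvent_eq_sum`). Taking entries
commutes with integration, so the formulas follow once `f(A)` is known to be the integral along the
given contour.

The contour `Γ₀` by which `f(A)` is defined surrounds only the ordinary spectrum, so it has to be
compared with `Γ`. This is the homology form of Cauchy's theorem, for Banach space valued functions
(`Contour.integral_eq_of_index_sub_eq`), proved by Dixon's method: a suitable modification of
`z ↦ ∫ (h(w) - h(z)) / (w - z) dw` is entire and vanishes at infinity, hence is zero by Liouville's
theorem. It is stated for two contours whose winding numbers differ by a constant `c` off the
domain `Ω` of `h`. With `c = 0` and `Ω = U \ σ(A)` it shows that `f(A)` does not depend on the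
contour.

With `c = 1`, the second contour empty, and `Ω` the complement of `σ(A)`, it shows that `f(A)` is
lower triangular, with no need for a contour around the causal spectrum: an entry of `f(z) R(z)`
above the diagonal vanishes off the causal spectrum, so it extends by zero to all of `Ω` and is zero
near infinity (`ClosedDirectSum.block_analyticFun_eq_zero`).
-/

noncomputable section

/-! ### Contour integrals -/

namespace Contour

open MeasureTheory Filter Topology

variable {F G : Type*} [NormedAddCommGroup F] [NormedSpace ℂ F]
  [NormedAddCommGroup G] [NormedSpace ℂ G]

/-- The velocity of the `k`-th arc (one-sided at the endpoints). -/
def velocity (Γ : Contour) (k : Fin Γ.n) (t : ℝ) : ℂ :=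
  derivWithin (Γ.arc k).extend (Set.Icc 0 1) t

theorem continuousOn_velocity (Γ : Contour) (k : Fin Γ.n) :
    ContinuousOn (Γ.velocity k) (Set.Icc 0 1) :=
  (Γ.contDiffOn k).continuousOn_derivWithin uniqueDiffOn_Icc_zero_one le_rfl

theorem extend_mem_support (Γ : Contour) (k : Fin Γ.n) (t : ℝ) :
    (Γ.arc k).extend t ∈ Γ.support :=
  Set.mem_iUnion.2 ⟨k, (Γ.arc k).extend_range ▸ Set.mem_range_self t⟩

theorem isCompact_support (Γ : Contour) : IsCompact Γ.support :=
  isCompact_iUnion fun k => isCompact_range (Γ.arc k).continuous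

theorem curveIntegralFun_form (Γ : Contour) (k : Fin Γ.n) (g : ℂ → F) (t : ℝ) :
    curveIntegralFun (form g) (Γ.arc k) t = Γ.velocity k t • g ((Γ.arc k).extend t) := by
  simp [curveIntegralFun_def, form, velocity]

theorem integral_eq_sum (Γ : Contour) (g : ℂ → F) :
    Γ.integral g = ∑ k, ∫ t in (0 : ℝ)..1, Γ.velocity k t • g ((Γ.arc k).extend t) := by
  simp only [integral, curveIntegral_def, curveIntegralFun_form]

theorem continuousOn_integrand (Γ : Contour) (k : Fin Γ.n) {g : ℂ → F}
    (hg : ContinuousOn g Γ.support) :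
    ContinuousOn (fun t => Γ.velocity k t • g ((Γ.arc k).extend t)) (Set.Icc 0 1) :=
  (Γ.continuousOn_velocity k).smul <|
    hg.comp (Γ.arc k).continuous_extend.continuousOn fun t _ => Γ.extend_mem_support k t

theorem intervalIntegrable_integrand (Γ : Contour) (k : Fin Γ.n) {g : ℂ → F}
    (hg : ContinuousOn g Γ.support) :
    IntervalIntegrable (fun t => Γ.velocity k t • g ((Γ.arc k).extend t)) volume 0 1 :=
  (Γ.continuousOn_integrand k hg).intervalIntegrable_of_Icc zero_le_one

theorem integrable_of_continuousOn (Γ : Contour) {g : ℂ → F} (hg : ContinuousOn g Γ.support) :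
    Γ.Integrable g := fun k => by
  simpa only [CurveIntegrable, funext (Γ.curveIntegralFun_form k g)]
    using Γ.intervalIntegrable_integrand k hg

theorem integral_congr (Γ : Contour) {g h : ℂ → F} (H : Set.EqOn g h Γ.support) :
    Γ.integral g = Γ.integral h := by
  simp only [integral_eq_sum]
  exact Finset.sum_congr rfl fun k _ => intervalIntegral.integral_congr fun t _ => by
    simp only [H (Γ.extend_mem_support k t)]

theorem integral_add (Γ : Contour) {g h : ℂ → F} (hg : ContinuousOn g Γ.support)
    (hh : ContinuousOn h Γ.support) :
    Γ.integral (fun z => g z + h z) = Γ.integral g + Γ.integral h := by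
  simp only [integral_eq_sum, smul_add, ← Finset.sum_add_distrib]
  exact Finset.sum_congr rfl fun k _ => intervalIntegral.integral_add
    (Γ.intervalIntegrable_integrand k hg) (Γ.intervalIntegrable_integrand k hh)

theorem integral_sub (Γ : Contour) {g h : ℂ → F} (hg : ContinuousOn g Γ.support)
    (hh : ContinuousOn h Γ.support) :
    Γ.integral (fun z => g z - h z) = Γ.integral g - Γ.integral h := by
  simp only [integral_eq_sum, smul_sub, ← Finset.sum_sub_distrib]
  exact Finset.sum_congr rfl fun k _ => intervalIntegral.integral_sub
    (Γ.intervalIntegrable_integrand k hg) (Γ.intervalIntegrable_integrand k hh)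

theorem integral_sum (Γ : Contour) {ι : Type*} (s : Finset ι) {g : ι → ℂ → F}
    (hg : ∀ i ∈ s, ContinuousOn (g i) Γ.support) :
    Γ.integral (fun z => ∑ i ∈ s, g i z) = ∑ i ∈ s, Γ.integral (g i) := by
  simp only [integral_eq_sum, Finset.smul_sum]
  rw [Finset.sum_comm]
  exact Finset.sum_congr rfl fun k _ => intervalIntegral.integral_finsetSum fun i hi =>
    Γ.intervalIntegrable_integrand k (hg i hi)

theorem integral_clm [CompleteSpace F] [CompleteSpace G] (Γ : Contour) (L : F →L[ℂ] G) {g : ℂ → F}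
    (hg : ContinuousOn g Γ.support) :
    Γ.integral (fun z => L (g z)) = L (Γ.integral g) := by
  simp only [integral_eq_sum, map_sum]
  refine Finset.sum_congr rfl fun k _ => ?_
  rw [← L.intervalIntegral_comp_comm (Γ.intervalIntegrable_integrand k hg)]
  simp only [map_smul]

theorem integral_smul_const [CompleteSpace F] (Γ : Contour) {g : ℂ → ℂ}
    (hg : ContinuousOn g Γ.support) (v : F) :
    Γ.integral (fun z => g z • v) = Γ.integral g • v :=
  Γ.integral_clm (ContinuousLinearMap.toSpanSingleton ℂ v) hg

theorem exists_norm_integral_le (Γ : Contour) : ∃ L : ℝ, ∀ (g : ℂ → F) (C : ℝ),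
    (∀ z ∈ Γ.support, ‖g z‖ ≤ C) → ‖Γ.integral g‖ ≤ L * C := by
  have hv (k : Fin Γ.n) : ∃ M, ∀ t ∈ Set.Icc (0 : ℝ) 1, ‖Γ.velocity k t‖ ≤ M :=
    isCompact_Icc.exists_bound_of_continuousOn (Γ.continuousOn_velocity k)
  choose M hM using hv
  refine ⟨∑ k, M k, fun g C hg => ?_⟩
  rw [integral_eq_sum, Finset.sum_mul]
  refine norm_sum_le_of_le _ fun k _ => ?_
  have := intervalIntegral.norm_integral_le_of_norm_le_const (a := (0 : ℝ)) (b := 1)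
    (C := M k * C) (f := fun t => Γ.velocity k t • g ((Γ.arc k).extend t)) fun t ht => by
      rw [Set.uIoc_of_le zero_le_one] at ht
      have h1 := hM k t (Set.Ioc_subset_Icc_self ht)
      rw [norm_smul]
      exact mul_le_mul h1 (hg _ (Γ.extend_mem_support k t)) (norm_nonneg _)
        ((norm_nonneg _).trans h1)
  simpa using this

/-- The integral of a function with a primitive vanishes, because a contour is a cycle. -/
theorem integral_eq_zero_of_hasDerivAt [CompleteSpace F] (Γ : Contour) {P g : ℂ → F}
    (hP : ∀ z ∈ Γ.support, HasDerivAt P (g z) z) (hg : ContinuousOn g Γ.support) :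
    Γ.integral g = 0 := by
  have key (k : Fin Γ.n) : ∫ t in (0 : ℝ)..1, Γ.velocity k t • g ((Γ.arc k).extend t) =
      P (Γ.tgt k) - P (Γ.src k) := by
    have hγ : Continuous (Γ.arc k).extend := (Γ.arc k).continuous_extend
    rw [intervalIntegral.integral_eq_sub_of_hasDerivAt_of_le zero_le_one
      (f := fun t => P ((Γ.arc k).extend t)) ?_ ?_ (Γ.intervalIntegrable_integrand k hg)]
    · simp
    · exact fun t _ => ((hP _ (Γ.extend_mem_support k t)).continuousAt.comp
        hγ.continuousAt).continuousWithinAt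
    · intro t ht
      have hd : HasDerivAt (Γ.arc k).extend (Γ.velocity k t) t :=
        (((Γ.contDiffOn k).differentiableOn one_ne_zero t
          (Set.Ioo_subset_Icc_self ht)).hasDerivWithinAt).hasDerivAt (Icc_mem_nhds ht.1 ht.2)
      exact (hP _ (Γ.extend_mem_support k t)).scomp t hd
  rw [integral_eq_sum, Finset.sum_congr rfl fun k _ => key k, Finset.sum_sub_distrib, sub_eq_zero]
  have h := congrArg (fun s => (s.map P).sum) Γ.closed
  simp only [Multiset.map_map] at h
  exact h.symm

/-- A contour integral depending holomorphically on a parameter may be differentiated under the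
integral sign. The derivative of the integrand is dominated by means of Cauchy's estimate. -/
theorem hasDerivAt_integral (Γ : Contour) {g : ℂ → ℂ → F} {z₀ : ℂ} {r C : ℝ}
    (hr : 0 < r) (hcont : ∀ z ∈ Metric.ball z₀ r, ContinuousOn (g z) Γ.support)
    (hdiff : ∀ w ∈ Γ.support, DifferentiableOn ℂ (fun z => g z w) (Metric.ball z₀ r))
    (hC : ∀ z ∈ Metric.ball z₀ r, ∀ w ∈ Γ.support, ‖g z w‖ ≤ C) :
    HasDerivAt (fun z => Γ.integral (g z))
      (Γ.integral fun w => deriv (fun z => g z w) z₀) z₀ := by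
  simp only [integral_eq_sum]
  refine HasDerivAt.fun_sum fun k _ => ?_
  have hr2 : 0 < r / 2 := half_pos hr
  have hd (w) (hw : w ∈ Γ.support) (z) (hz : z ∈ Metric.ball z₀ r) :
      HasDerivAt (fun z => g z w) (deriv (fun z => g z w) z) z :=
    ((hdiff w hw).differentiableAt (Metric.isOpen_ball.mem_nhds hz)).hasDerivAt
  have hz₀ : z₀ ∈ Metric.ball z₀ r := Metric.mem_ball_self hr
  have hmeas (z) (hz : z ∈ Metric.ball z₀ r) := (Γ.intervalIntegrable_integrand k
    (hcont z hz)).def'.aestronglyMeasurable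
  refine (intervalIntegral.hasDerivAt_integral_of_dominated_loc_of_deriv_le
    (F := fun z t => Γ.velocity k t • g z ((Γ.arc k).extend t))
    (F' := fun z t => Γ.velocity k t • deriv (fun z => g z ((Γ.arc k).extend t)) z)
    (bound := fun t => ‖Γ.velocity k t‖ * (C / (r / 2)))
    (Metric.ball_mem_nhds z₀ hr2) ?_ (Γ.intervalIntegrable_integrand k (hcont _ hz₀))
    ?_ ?_ ?_ ?_).2
  · filter_upwards [Metric.ball_mem_nhds z₀ hr] with z hz using hmeas z hz
  · -- the derivative is measurable in `t` as a limit of difference quotients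
    have hu : Tendsto (fun m : ℕ => z₀ + (r / 2 : ℝ) * ((1 / ((m : ℝ) + 1) : ℝ) : ℂ)) atTop
        (𝓝[≠] z₀) := by
      refine tendsto_nhdsWithin_iff.2 ⟨?_, Eventually.of_forall fun m => ?_⟩
      · have h0 := (Complex.continuous_ofReal.tendsto 0).comp
          (tendsto_one_div_add_atTop_nhds_zero_nat (𝕜 := ℝ))
        simpa using (h0.const_mul ((r / 2 : ℝ) : ℂ)).const_add z₀
      · simpa using ⟨hr.ne', by exact_mod_cast (m.cast_add_one_ne_zero : (m : ℂ) + 1 ≠ 0)⟩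
    have hball : ∀ᶠ m in atTop, z₀ + (r / 2 : ℝ) * ((1 / ((m : ℕ) + 1 : ℝ) : ℝ) : ℂ)
        ∈ Metric.ball z₀ r :=
      (hu.mono_right nhdsWithin_le_nhds).eventually (Metric.ball_mem_nhds z₀ hr)
    obtain ⟨N, hN⟩ := eventually_atTop.1 hball
    refine aestronglyMeasurable_of_tendsto_ae atTop (f := fun (m : ℕ) t =>
      (z₀ + (r / 2 : ℝ) * ((1 / (((m + N : ℕ) : ℝ) + 1 : ℝ) : ℝ) : ℂ) - z₀)⁻¹ •
        (Γ.velocity k t • g (z₀ + (r / 2 : ℝ) * ((1 / (((m + N : ℕ) : ℝ) + 1 : ℝ) : ℝ) : ℂ))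
          ((Γ.arc k).extend t) - Γ.velocity k t • g z₀ ((Γ.arc k).extend t))) (fun m => ?_) ?_
    · exact ((hmeas _ (hN _ (Nat.le_add_left _ _))).sub (hmeas _ hz₀)).const_smul _
    · refine Eventually.of_forall fun t => ?_
      have := (hasDerivAt_iff_tendsto_slope.1
        ((hd _ (Γ.extend_mem_support k t) _ hz₀).const_smul (Γ.velocity k t))).comp
        (hu.comp (tendsto_add_atTop_nat N))
      exact this
  · refine Eventually.of_forall fun t _ z hz => ?_
    rw [norm_smul]
    refine mul_le_mul_of_nonneg_left ?_ (norm_nonneg _)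
    have hsub : Metric.closedBall z (r / 2) ⊆ Metric.ball z₀ r := fun y hy => by
      rw [Metric.mem_ball] at hz ⊢
      rw [Metric.mem_closedBall] at hy
      linarith [dist_triangle y z z₀]
    exact Complex.norm_deriv_le_of_forall_mem_sphere_norm_le hr2
      (((hdiff _ (Γ.extend_mem_support k t)).mono hsub).diffContOnCl_ball subset_rfl)
      fun y hy => hC y (hsub (Metric.sphere_subset_closedBall hy)) _ (Γ.extend_mem_support k t)
  · exact ((Γ.continuousOn_velocity k).norm.mul
      continuousOn_const).intervalIntegrable_of_Icc zero_le_one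
  · refine Eventually.of_forall fun t _ z hz => ?_
    exact (hd _ (Γ.extend_mem_support k t) z
      (Metric.ball_subset_ball (by linarith) hz)).const_smul _

end Contour

/-! ### Winding numbers -/

namespace Contour

open Filter Topology

variable {F : Type*} [NormedAddCommGroup F] [NormedSpace ℂ F]

theorem sub_ne_zero_of_mem_support {Γ : Contour} {z w : ℂ} (hz : z ∉ Γ.support)
    (hw : w ∈ Γ.support) : w - z ≠ 0 :=
  sub_ne_zero.2 fun h => hz (h ▸ hw)

theorem continuousOn_cauchyKernel {Γ : Contour} {z : ℂ} (hz : z ∉ Γ.support) :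
    ContinuousOn (fun w => (w - z)⁻¹) Γ.support :=
  (continuousOn_id.sub continuousOn_const).inv₀ fun _ hw => sub_ne_zero_of_mem_support hz hw

theorem integral_cauchyKernel (Γ : Contour) (z : ℂ) :
    Γ.integral (fun w => (w - z)⁻¹) = 2 * (Real.pi : ℂ) * Complex.I * Γ.index z := by
  have : (2 * (Real.pi : ℂ) * Complex.I) ≠ 0 := Complex.two_pi_I_ne_zero
  rw [index, normIntegral, smul_eq_mul, mul_inv_cancel_left₀ this]

/-- The derivative of the Cauchy transform `z ↦ ∫_Γ h(w) / (w - z) dw` off the contour. -/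
theorem hasDerivAt_cauchyTransform (Γ : Contour) {h : ℂ → F} (hh : ContinuousOn h Γ.support)
    {z₀ : ℂ} (hz₀ : z₀ ∉ Γ.support) :
    HasDerivAt (fun z => Γ.integral fun w => (w - z)⁻¹ • h w)
      (Γ.integral fun w => ((w - z₀) ^ 2)⁻¹ • h w) z₀ := by
  obtain ⟨r, hr, hball⟩ := Metric.isOpen_iff.1 Γ.isCompact_support.isClosed.isOpen_compl z₀ hz₀
  obtain ⟨C, hC⟩ := Γ.isCompact_support.exists_bound_of_continuousOn hh
  have hr2 := half_pos hr
  have hsub : Metric.ball z₀ (r / 2) ⊆ Metric.ball z₀ r := Metric.ball_subset_ball (by linarith)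
  have hd (w) (hw : w ∈ Γ.support) (z) (hz : z ∉ Γ.support) :
      HasDerivAt (fun z => (w - z)⁻¹ • h w) (((w - z) ^ 2)⁻¹ • h w) z := by
    simpa using ((((hasDerivAt_id z).const_sub w).inv
      (sub_ne_zero_of_mem_support hz hw)).smul_const (h w))
  have := Γ.hasDerivAt_integral (g := fun z w => (w - z)⁻¹ • h w) (z₀ := z₀) (r := r / 2)
    (C := (r / 2)⁻¹ * C) hr2 (fun z hz => (continuousOn_cauchyKernel (hball (hsub hz))).smul hh)
    (fun w hw z hz =>
      (hd w hw z (hball (hsub hz))).differentiableAt.differentiableWithinAt) ?_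
  · convert this using 1
    exact Γ.integral_congr fun w hw => (hd w hw z₀ hz₀).deriv.symm
  · intro z hz w hw
    have hw' : r ≤ dist w z₀ := by
      by_contra! hlt
      exact hball (Metric.mem_ball.2 hlt) hw
    have : r / 2 ≤ ‖w - z‖ := by
      rw [Metric.mem_ball] at hz
      rw [← dist_eq_norm]
      linarith [dist_triangle w z z₀]
    rw [norm_smul, norm_inv]
    exact mul_le_mul (inv_anti₀ hr2 this) (hC w hw) (norm_nonneg _) (by positivity)

/-- The winding number has zero derivative, since `(w - z)⁻²` has a primitive in `w`. -/
theorem hasDerivAt_index (Γ : Contour) {z₀ : ℂ} (hz₀ : z₀ ∉ Γ.support) :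
    HasDerivAt Γ.index 0 z₀ := by
  have h := Γ.hasDerivAt_cauchyTransform (h := fun _ => (1 : ℂ)) continuousOn_const hz₀
  have h0 : Γ.integral (fun w => ((w - z₀) ^ 2)⁻¹ • (1 : ℂ)) = 0 := by
    refine Γ.integral_eq_zero_of_hasDerivAt (P := fun w => -(w - z₀)⁻¹) (fun w hw => ?_) ?_
    · have := (((hasDerivAt_id w).sub_const z₀).fun_inv (sub_ne_zero_of_mem_support hz₀ hw)).fun_neg
      simpa [neg_div] using this
    · exact ((((continuousOn_id.sub continuousOn_const).pow 2).inv₀ fun w hw =>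
        pow_ne_zero 2 (sub_ne_zero_of_mem_support hz₀ hw))).smul continuousOn_const
  rw [h0] at h
  have := h.const_smul (2 * (Real.pi : ℂ) * Complex.I)⁻¹
  simp only [smul_zero] at this
  refine this.congr_of_eventuallyEq (Eventually.of_forall fun z => ?_)
  simp [index, normIntegral]

theorem eventually_index_eq (Γ : Contour) {z₀ : ℂ} (hz₀ : z₀ ∉ Γ.support) :
    ∀ᶠ z in 𝓝 z₀, Γ.index z = Γ.index z₀ := by
  obtain ⟨r, hr, hball⟩ := Metric.isOpen_iff.1 Γ.isCompact_support.isClosed.isOpen_compl z₀ hz₀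
  filter_upwards [Metric.ball_mem_nhds z₀ hr] with z hz
  exact (convex_ball z₀ r).is_const_of_fderivWithin_eq_zero (𝕜 := ℂ)
    (fun w hw => (Γ.hasDerivAt_index (hball hw)).differentiableAt.differentiableWithinAt)
    (fun w hw => by
      rw [fderivWithin_of_isOpen Metric.isOpen_ball hw]
      simpa using (Γ.hasDerivAt_index (hball hw)).hasFDerivAt.fderiv)
    hz (Metric.mem_ball_self hr)

/-- A contour does not wind around points far away: `log (1 - w / z)` is a primitive of
`(w - z)⁻¹` in the disk `|w| < |z|`. -/
theorem eventually_index_eq_zero (Γ : Contour) : ∀ᶠ z in cocompact ℂ, Γ.index z = 0 := by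
  obtain ⟨R, hR⟩ := Γ.isCompact_support.isBounded.exists_norm_le
  have hR' : ∀ᶠ z : ℂ in cocompact ℂ, max R 0 < ‖z‖ :=
    (tendsto_norm_cocompact_atTop (E := ℂ)).eventually (eventually_gt_atTop _)
  filter_upwards [hR'] with z hz
  have hz0 : z ≠ 0 := norm_pos_iff.1 ((le_max_right _ _).trans_lt hz)
  have hz' : z ∉ Γ.support := fun h => ((hR z h).trans (le_max_left _ _)).not_gt hz
  have : Γ.integral (fun w => (w - z)⁻¹) = 0 := by
    refine Γ.integral_eq_zero_of_hasDerivAt (P := fun w => Complex.log (1 - w / z))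
      (fun w hw => ?_) (continuousOn_cauchyKernel hz')
    have hlt : ‖w / z‖ < 1 := by
      rw [norm_div, div_lt_one (norm_pos_iff.2 hz0)]
      exact ((hR w hw).trans (le_max_left _ _)).trans_lt hz
    have hs : 1 - w / z ∈ Complex.slitPlane := by
      refine Or.inl ?_
      have := (Complex.re_le_norm (w / z)).trans_lt hlt
      simpa using this
    have hne := sub_ne_zero_of_mem_support hz' hw
    have h1 : z - w ≠ 0 := fun h => hne (by rw [← neg_sub, h, neg_zero])
    have h2 : (w - z)⁻¹ = -(1 / z) / (1 - w / z) := by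
      rw [one_sub_div hz0, ← neg_sub z w]
      field_simp
    rw [h2]
    exact (((hasDerivAt_id w).div_const z).const_sub 1).clog hs
  rw [index, normIntegral, this, smul_zero]

theorem eventually_notMem_support (Γ : Contour) : ∀ᶠ z in cocompact ℂ, z ∉ Γ.support :=
  Γ.isCompact_support.compl_mem_cocompact

theorem tendsto_cauchyTransform (Γ : Contour) {h : ℂ → F} (hh : ContinuousOn h Γ.support) :
    Tendsto (fun z => Γ.integral fun w => (w - z)⁻¹ • h w) (cocompact ℂ) (𝓝 0) := by
  obtain ⟨R, hR⟩ := Γ.isCompact_support.isBounded.exists_norm_le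
  obtain ⟨C, hC⟩ := Γ.isCompact_support.exists_bound_of_continuousOn hh
  obtain ⟨L, hL⟩ := Γ.exists_norm_integral_le (F := F)
  have hn : Tendsto (fun z : ℂ => ‖z‖ - R) (cocompact ℂ) atTop :=
    tendsto_atTop_add_const_right _ _ tendsto_norm_cocompact_atTop
  have hlim : Tendsto (fun z : ℂ => L * ((‖z‖ - R)⁻¹ * C)) (cocompact ℂ) (𝓝 0) := by
    simpa using ((tendsto_inv_atTop_zero.comp hn).mul_const C).const_mul L
  refine squeeze_zero_norm' ?_ hlim
  filter_upwards [hn.eventually (eventually_gt_atTop 0)] with z hz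
  refine hL _ _ fun w hw => ?_
  have : ‖z‖ - R ≤ ‖w - z‖ := by
    have := norm_sub_norm_le z w
    rw [norm_sub_rev] at this
    linarith [hR w hw]
  rw [norm_smul, norm_inv]
  exact mul_le_mul (inv_anti₀ hz this) (hC w hw) (norm_nonneg _) (by positivity)

/-! ### The homology form of Cauchy's theorem -/

/-- The integral `∫_Γ (h(w) - h(z)) / (w - z) dw` is holomorphic in `z` across the contour too. -/
theorem differentiableAt_integral_dslope [CompleteSpace F] (Γ : Contour) {Ω : Set ℂ}
    (hΩ : IsOpen Ω) (hΓ : Γ.support ⊆ Ω) {h : ℂ → F} (hh : DifferentiableOn ℂ h Ω) {z₀ : ℂ}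
    (hz₀ : z₀ ∈ Ω) : DifferentiableAt ℂ (fun z => Γ.integral (dslope h z)) z₀ := by
  obtain ⟨ρ, hρ, hball⟩ := Metric.isOpen_iff.1 hΩ z₀ hz₀
  have hρ2 := half_pos hρ
  have hcl : Metric.closedBall z₀ (ρ / 2) ⊆ Ω :=
    (Metric.closedBall_subset_ball (by linarith)).trans hball
  obtain ⟨C₁, hC₁⟩ := (isCompact_closedBall z₀ (ρ / 2)).exists_bound_of_continuousOn
    (hh.deriv hΩ |>.continuousOn.mono hcl)
  obtain ⟨C₂, hC₂⟩ := (isCompact_closedBall z₀ (ρ / 2)).exists_bound_of_continuousOn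
    (hh.continuousOn.mono hcl)
  obtain ⟨C₃, hC₃⟩ := Γ.isCompact_support.exists_bound_of_continuousOn (hh.continuousOn.mono hΓ)
  have hr : 0 < ρ / 4 := by positivity
  have hsub : Metric.ball z₀ (ρ / 4) ⊆ Metric.closedBall z₀ (ρ / 2) :=
    Metric.ball_subset_closedBall.trans (Metric.closedBall_subset_closedBall (by linarith))
  have hds (z) (hz : z ∈ Ω) : DifferentiableOn ℂ (dslope h z) Ω :=
    (Complex.differentiableOn_dslope (hΩ.mem_nhds hz)).2 hh
  have hsymm (z w : ℂ) : dslope h z w = dslope h w z := by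
    rcases eq_or_ne z w with rfl | hzw
    · rfl
    · rw [dslope_of_ne _ hzw.symm, dslope_of_ne _ hzw, slope_comm]
  refine (Γ.hasDerivAt_integral (g := fun z w => dslope h z w) (z₀ := z₀) (r := ρ / 4)
    (C := max C₁ ((ρ / 4)⁻¹ * (C₃ + C₂))) hr
    (fun z hz => ((hds z (hcl (hsub hz))).continuousOn.mono hΓ)) (fun w hw => ?_) ?_).differentiableAt
  · simp only [hsymm _ w]
    exact (hds w (hΓ hw)).mono (hsub.trans hcl)
  · intro z hz w hw
    by_cases hwb : w ∈ Metric.closedBall z₀ (ρ / 2)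
    -- for `w` near `z₀` the mean value inequality applies
    · refine le_max_of_le_left ?_
      rcases eq_or_ne w z with rfl | hne
      · rw [dslope_same]
        exact hC₁ w hwb
      · rw [dslope_of_ne _ hne, slope_def_module, norm_smul, norm_inv]
        have hmv := (convex_closedBall z₀ (ρ / 2)).norm_image_sub_le_of_norm_deriv_le (𝕜 := ℂ)
          (f := h) (fun x hx => hh.differentiableAt (hΩ.mem_nhds (hcl hx))) hC₁ (hsub hz) hwb
        have hpos : 0 < ‖w - z‖ := norm_pos_iff.2 (sub_ne_zero.2 hne)
        rw [inv_mul_le_iff₀ hpos, mul_comm]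
        exact hmv
    -- the other `w` are bounded away from `z`
    · refine le_max_of_le_right ?_
      rw [Metric.mem_closedBall, not_le] at hwb
      have hdist : ρ / 4 ≤ ‖w - z‖ := by
        rw [Metric.mem_ball] at hz
        rw [← dist_eq_norm]
        linarith [dist_triangle w z z₀]
      have hne : w ≠ z := by
        rintro rfl
        simp at hdist
        linarith
      rw [dslope_of_ne _ hne, slope_def_module, norm_smul, norm_inv]
      refine mul_le_mul (inv_anti₀ hr hdist) ?_ (norm_nonneg _) (by positivity)
      exact (norm_sub_le _ _).trans (add_le_add (hC₃ w hw) (hC₂ z (hsub hz)))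

theorem integral_dslope [CompleteSpace F] (Γ : Contour) {h : ℂ → F} (hh : ContinuousOn h Γ.support)
    {z : ℂ} (hz : z ∉ Γ.support) :
    Γ.integral (dslope h z) = (Γ.integral fun w => (w - z)⁻¹ • h w) -
      (2 * (Real.pi : ℂ) * Complex.I * Γ.index z) • h z := by
  have hk := continuousOn_cauchyKernel hz
  rw [← integral_cauchyKernel, ← Γ.integral_smul_const hk,
    ← Γ.integral_sub (g := fun w => (w - z)⁻¹ • h w) (h := fun w => (w - z)⁻¹ • h z)
      (hk.smul hh) (hk.smul continuousOn_const)]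
  refine Γ.integral_congr fun w hw => ?_
  rw [dslope_of_ne _ (sub_ne_zero.1 (sub_ne_zero_of_mem_support hz hw)), slope_def_module, smul_sub]

open Classical in
/-- Dixon's lemma for the cycle `Γ - Γ'`, whose winding number is assumed to have one and the same
value `c` off `Ω`: the function which is `∫ (h(w) - h(z)) / (w - z) dw + 2πi c h(z)` in `Ω` and
`∫ h(w) / (w - z) dw` off `Ω` is entire and vanishes at infinity. -/
theorem cauchyTransform_eq_of_index_sub_eq [CompleteSpace F] {Γ Γ' : Contour} {Ω : Set ℂ}
    (hΩ : IsOpen Ω) (hΓ : Γ.support ⊆ Ω) (hΓ' : Γ'.support ⊆ Ω) {c : ℂ}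
    (hc : ∀ w, w ∉ Ω → Γ.index w - Γ'.index w = c) {h : ℂ → F} (hh : DifferentiableOn ℂ h Ω)
    (hinf : ∀ᶠ z in cocompact ℂ, c • h z = 0) {z : ℂ} (hz : z ∉ Γ.support) (hz' : z ∉ Γ'.support)
    (hind : Γ.index z = Γ'.index z) (hcz : c • h z = 0) :
    (Γ.integral fun w => (w - z)⁻¹ • h w) = Γ'.integral fun w => (w - z)⁻¹ • h w := by
  have hhΓ := hh.continuousOn.mono hΓ
  have hhΓ' := hh.continuousOn.mono hΓ'
  set T : ℂ → F := fun z => (Γ.integral fun w => (w - z)⁻¹ • h w) -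
    Γ'.integral fun w => (w - z)⁻¹ • h w with hT
  set E : ℂ → F := fun z => if z ∈ Ω then
    Γ.integral (dslope h z) - Γ'.integral (dslope h z) +
      (2 * (Real.pi : ℂ) * Complex.I) • c • h z else T z with hE
  have hET (z) (h1 : z ∉ Γ.support) (h2 : z ∉ Γ'.support) : E z = T z + if z ∈ Ω then
      (2 * (Real.pi : ℂ) * Complex.I * (c - (Γ.index z - Γ'.index z))) • h z else 0 := by
    by_cases hzΩ : z ∈ Ω
    · simp only [hE, hT, if_pos hzΩ, Γ.integral_dslope hhΓ h1, Γ'.integral_dslope hhΓ' h2]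
      module
    · simp only [hE, if_neg hzΩ, add_zero]
  have hdiff : Differentiable ℂ E := by
    intro z
    by_cases hzΩ : z ∈ Ω
    · have : E =ᶠ[𝓝 z] fun z => Γ.integral (dslope h z) - Γ'.integral (dslope h z) +
          (2 * (Real.pi : ℂ) * Complex.I) • c • h z := by
        filter_upwards [hΩ.mem_nhds hzΩ] with y hy using if_pos hy
      refine DifferentiableAt.congr_of_eventuallyEq ?_ this
      exact ((Γ.differentiableAt_integral_dslope hΩ hΓ hh hzΩ).sub
        (Γ'.differentiableAt_integral_dslope hΩ hΓ' hh hzΩ)).add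
        (((hh.differentiableAt (hΩ.mem_nhds hzΩ)).const_smul c).const_smul _)
    · have h1 : z ∉ Γ.support := fun h => hzΩ (hΓ h)
      have h2 : z ∉ Γ'.support := fun h => hzΩ (hΓ' h)
      have : E =ᶠ[𝓝 z] T := by
        filter_upwards [Γ.eventually_index_eq h1, Γ'.eventually_index_eq h2,
          Γ.isCompact_support.isClosed.isOpen_compl.mem_nhds h1,
          Γ'.isCompact_support.isClosed.isOpen_compl.mem_nhds h2] with y e1 e2 n1 n2
        rw [hET y n1 n2, e1, e2, hc z hzΩ]
        simp
      refine DifferentiableAt.congr_of_eventuallyEq ?_ this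
      exact (Γ.hasDerivAt_cauchyTransform hhΓ h1).differentiableAt.sub
        (Γ'.hasDerivAt_cauchyTransform hhΓ' h2).differentiableAt
  have hET' (z) (h1 : z ∉ Γ.support) (h2 : z ∉ Γ'.support) (h3 : Γ.index z = Γ'.index z)
      (h4 : c • h z = 0) : E z = T z := by
    rw [hET z h1 h2, h3, sub_self, sub_zero, mul_smul, h4, smul_zero, ite_self, add_zero]
  have hlim : Tendsto E (cocompact ℂ) (𝓝 0) := by
    have hT0 : Tendsto T (cocompact ℂ) (𝓝 0) := by
      simpa using (Γ.tendsto_cauchyTransform hhΓ).sub (Γ'.tendsto_cauchyTransform hhΓ')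
    refine hT0.congr' ?_
    filter_upwards [Γ.eventually_index_eq_zero, Γ'.eventually_index_eq_zero,
      Γ.eventually_notMem_support, Γ'.eventually_notMem_support, hinf] with y e1 e2 n1 n2 e3
    exact (hET' y n1 n2 (e1.trans e2.symm) e3).symm
  have h0 := hdiff.apply_eq_of_tendsto_cocompact z hlim
  rw [hET' z hz hz' hind hcz] at h0
  exact sub_eq_zero.1 h0

/-- **Cauchy's theorem**, homology form: if the winding numbers of two contours in `Ω` differ by
the same constant `c` at all points off `Ω`, then a holomorphic function in `Ω` has equal integrals
along them, provided that `c = 0` or the function vanishes near infinity. -/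
theorem integral_eq_of_index_sub_eq [CompleteSpace F] {Γ Γ' : Contour} {Ω : Set ℂ}
    (hΩ : IsOpen Ω) (hΓ : Γ.support ⊆ Ω) (hΓ' : Γ'.support ⊆ Ω) {c : ℂ}
    (hc : ∀ w, w ∉ Ω → Γ.index w - Γ'.index w = c) {h : ℂ → F} (hh : DifferentiableOn ℂ h Ω)
    (hinf : ∀ᶠ z in cocompact ℂ, c • h z = 0) : Γ.integral h = Γ'.integral h := by
  obtain ⟨z, e1, e2, n1, n2⟩ := (Γ.eventually_index_eq_zero.and
    (Γ'.eventually_index_eq_zero.and (Γ.eventually_notMem_support.and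
      Γ'.eventually_notMem_support))).exists
  -- apply Dixon's lemma at `z` to the function `(w - z) h(w)`
  have key := cauchyTransform_eq_of_index_sub_eq hΩ hΓ hΓ' hc
    (h := fun w => (w - z) • h w) ((differentiableOn_id.sub_const z).smul hh) (by
      filter_upwards [hinf] with y hy
      rw [smul_comm, hy, smul_zero]) n1 n2 (e1.trans e2.symm) (by simp)
  have hred (Δ : Contour) (hΔ : z ∉ Δ.support) :
      (Δ.integral fun w => (w - z)⁻¹ • (w - z) • h w) = Δ.integral h :=
    Δ.integral_congr fun w hw => inv_smul_smul₀ (sub_ne_zero_of_mem_support hΔ hw) _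
  rwa [hred Γ n1, hred Γ' n2] at key

end Contour

/-! ### Blocks of operators and of causal resolvents -/

namespace ClosedDirectSum

variable {X : Type*} [NormedAddCommGroup X] [NormedSpace ℂ X] [CompleteSpace X] {n : ℕ}

theorem component_coe_self (D : ClosedDirectSum X n) (i : Fin n) (y : D.V i) :
    D.component i (y : X) = y := by
  have h := D.sum_component (y : X)
  rw [Finset.sum_eq_single i (fun k _ hk => by rw [D.component_coe k i y hk]; rfl) (by simp)] at h
  exact Subtype.ext h

theorem block_sub (D : ClosedDirectSum X n) (A B : X →L[ℂ] X) (i j : Fin n) :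
    D.block (A - B) i j = D.block A i j - D.block B i j := by
  ext1 y
  exact map_sub (D.component i) (A y) (B y)

theorem block_smul (D : ClosedDirectSum X n) (r : ℂ) (A : X →L[ℂ] X) (i j : Fin n) :
    D.block (r • A) i j = r • D.block A i j := by
  ext1 y
  exact map_smul (D.component i) r (A y)

theorem block_zero (D : ClosedDirectSum X n) (i j : Fin n) : D.block 0 i j = 0 := by
  ext1 y
  exact map_zero (D.component i)

theorem differentiableAt_block (D : ClosedDirectSum X n) {g : ℂ → X →L[ℂ] X} {z : ℂ}
    (hg : DifferentiableAt ℂ g z) (i j : Fin n) :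
    DifferentiableAt ℂ (fun z => D.block (g z) i j) z :=
  (differentiableAt_const (D.component i)).clm_comp
    (hg.clm_comp (differentiableAt_const (D.V j).subtypeL))

theorem continuous_block (D : ClosedDirectSum X n) (i j : Fin n) :
    Continuous fun A : X →L[ℂ] X => D.block A i j :=
  continuous_const.clm_comp (continuous_id.clm_comp continuous_const)

theorem block_one_self (D : ClosedDirectSum X n) (i : Fin n) : D.block 1 i i = 1 := by
  ext1 y
  exact D.component_coe_self i y

theorem block_one_of_ne (D : ClosedDirectSum X n) {i j : Fin n} (h : i ≠ j) :
    D.block 1 i j = 0 := by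
  ext1 y
  exact D.component_coe i j y h

theorem block_algebraMap_sub (D : ClosedDirectSum X n) (A : X →L[ℂ] X) (z : ℂ) (i j : Fin n) :
    D.block (algebraMap ℂ _ z - A) i j = z • D.block 1 i j - D.block A i j := by
  rw [Algebra.algebraMap_eq_smul_one, block_sub, block_smul]

theorem block_algebraMap_sub_of_ne (D : ClosedDirectSum X n) (A : X →L[ℂ] X) (z : ℂ)
    {i j : Fin n} (h : i ≠ j) : D.block (algebraMap ℂ _ z - A) i j = -D.block A i j := by
  rw [block_algebraMap_sub, block_one_of_ne D h, sub_eq_neg_self]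
  exact smul_zero (A := D.V j →L[ℂ] D.V i) z

theorem isClosed_causal (D : ClosedDirectSum X n) : IsClosed (D.causal : Set (X →L[ℂ] X)) := by
  have : (D.causal : Set (X →L[ℂ] X)) = ⋂ i, ⋂ j, ⋂ _ : i < j, (fun A => D.block A i j) ⁻¹' {0} := by
    ext A
    simp only [Set.mem_iInter]
    rfl
  rw [this]
  exact isClosed_iInter fun i => isClosed_iInter fun j => isClosed_iInter fun _ =>
    isClosed_singleton.preimage (D.continuous_block i j)

instance (D : ClosedDirectSum X n) : CompleteSpace D.causal :=
  D.isClosed_causal.completeSpace_coe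

theorem block_mul_self_of_causal (D : ClosedDirectSum X n) {A B : X →L[ℂ] X} (hA : A ∈ D.causal)
    (hB : B ∈ D.causal) (i : Fin n) : D.block (A * B) i i = D.block A i i * D.block B i i := by
  rw [block_mul]
  refine Finset.sum_eq_single i (fun k _ hk => ?_) (by simp)
  rcases lt_or_gt_of_ne hk with h | h
  · rw [hB k i h, ContinuousLinearMap.comp_zero]
  · rw [hA i k h, ContinuousLinearMap.zero_comp]

variable {D : ClosedDirectSum X n} {A : D.causal} {z : ℂ}

theorem spectrum_subset_causalSpectrum (D : ClosedDirectSum X n) (A : D.causal) :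
    spectrum ℂ (A : X →L[ℂ] X) ⊆ D.causalSpectrum A :=
  spectrum.subset_subalgebra A

theorem mem_resolventSet (hz : z ∉ D.causalSpectrum A) : z ∈ resolventSet ℂ (A : X →L[ℂ] X) :=
  not_not.1 fun h => hz (D.spectrum_subset_causalSpectrum A h)

theorem mul_resolvent (hz : z ∈ resolventSet ℂ (A : X →L[ℂ] X)) :
    (algebraMap ℂ _ z - (A : X →L[ℂ] X)) * resolvent (A : X →L[ℂ] X) z = 1 :=
  Ring.mul_inverse_cancel _ hz

theorem resolvent_mul (hz : z ∈ resolventSet ℂ (A : X →L[ℂ] X)) :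
    resolvent (A : X →L[ℂ] X) z * (algebraMap ℂ _ z - (A : X →L[ℂ] X)) = 1 :=
  Ring.inverse_mul_cancel _ hz

theorem algebraMap_sub_mem_causal (D : ClosedDirectSum X n) (A : D.causal) (z : ℂ) :
    algebraMap ℂ _ z - (A : X →L[ℂ] X) ∈ D.causal :=
  D.causal.sub_mem (D.causal.algebraMap_mem z) A.2

theorem resolvent_mem_causal (hz : z ∉ D.causalSpectrum A) :
    resolvent (A : X →L[ℂ] X) z ∈ D.causal := by
  have hu : IsUnit (algebraMap ℂ D.causal z - A) := not_not.1 hz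
  have h1 : (algebraMap ℂ _ z - (A : X →L[ℂ] X)) *
      (Ring.inverse (algebraMap ℂ D.causal z - A) : D.causal) = 1 :=
    congrArg Subtype.val (Ring.mul_inverse_cancel _ hu)
  have h2 : resolvent (A : X →L[ℂ] X) z =
      (Ring.inverse (algebraMap ℂ D.causal z - A) : D.causal) := by
    calc resolvent (A : X →L[ℂ] X) z
        = resolvent (A : X →L[ℂ] X) z * ((algebraMap ℂ _ z - (A : X →L[ℂ] X)) *
            (Ring.inverse (algebraMap ℂ D.causal z - A) : D.causal)) := by
          rw [h1, mul_one]
      _ = _ := by rw [← mul_assoc, resolvent_mul (mem_resolventSet hz), one_mul]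
  rw [h2]
  exact Subtype.coe_prop _

theorem algebraMap_sub_block (D : ClosedDirectSum X n) (A : X →L[ℂ] X) (z : ℂ) (i : Fin n) :
    D.block (algebraMap ℂ _ z - A) i i = algebraMap ℂ _ z - D.block A i i := by
  rw [block_algebraMap_sub, block_one_self, Algebra.algebraMap_eq_smul_one]

/-- Off the causal spectrum the diagonal blocks of the resolvent invert those of `z - A`. -/
theorem mem_resolventSet_block (hz : z ∉ D.causalSpectrum A) (i : Fin n) :
    z ∈ resolventSet ℂ (D.block (A : X →L[ℂ] X) i i) := by
  have hR := resolvent_mem_causal hz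
  have hzA := D.algebraMap_sub_mem_causal A z
  have hr := mem_resolventSet hz
  rw [spectrum.mem_resolventSet_iff, ← algebraMap_sub_block]
  refine isUnit_iff_exists.2 ⟨D.block (resolvent (A : X →L[ℂ] X) z) i i, ?_, ?_⟩
  · rw [← D.block_mul_self_of_causal hzA hR, mul_resolvent hr, block_one_self]
  · rw [← D.block_mul_self_of_causal hR hzA, resolvent_mul hr, block_one_self]

/-- Forward substitution for `(z - A) R = 1`. -/
theorem block_resolvent (hz : z ∉ D.causalSpectrum A) (i j : Fin n) :
    D.block (resolvent (A : X →L[ℂ] X) z) i j = D.blockResolvent (A : X →L[ℂ] X) i z ∘L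
      (D.block 1 i j + ∑ k ∈ Finset.Iio i, D.block (A : X →L[ℂ] X) i k ∘L
        D.block (resolvent (A : X →L[ℂ] X) z) k j) := by
  set R := resolvent (A : X →L[ℂ] X) z with hR
  set B : X →L[ℂ] X := algebraMap ℂ _ z - (A : X →L[ℂ] X) with hB
  have h1 : ∑ k, D.block B i k ∘L D.block R k j = D.block 1 i j := by
    rw [← block_mul, mul_resolvent (mem_resolventSet hz)]
  have hsplit : ∑ k, D.block B i k ∘L D.block R k j =
      D.block B i i ∘L D.block R i j - ∑ k ∈ Finset.Iio i,
        D.block (A : X →L[ℂ] X) i k ∘L D.block R k j := by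
    rw [← Finset.sum_subset (Finset.subset_univ (Finset.Iic i)) fun k _ hk => ?_,
      ← Finset.Iio_insert, Finset.sum_insert (by simp), sub_eq_add_neg,
      ← Finset.sum_neg_distrib]
    · congr 1
      refine Finset.sum_congr rfl fun k hk => ?_
      rw [hB, block_algebraMap_sub_of_ne D _ z (Finset.mem_Iio.1 hk).ne',
        ContinuousLinearMap.neg_comp]
    · rw [D.algebraMap_sub_mem_causal A z i k (by simpa using hk), ContinuousLinearMap.zero_comp]
  have h2 : D.block 1 i j + ∑ k ∈ Finset.Iio i, D.block (A : X →L[ℂ] X) i k ∘L D.block R k j =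
      D.block B i i ∘L D.block R i j := by
    rw [← h1, hsplit, sub_add_cancel]
  have h3 : D.blockResolvent (A : X →L[ℂ] X) i z * D.block B i i = 1 := by
    rw [hB, algebraMap_sub_block]
    exact Ring.inverse_mul_cancel _ (mem_resolventSet_block hz i)
  rw [h2, ← ContinuousLinearMap.comp_assoc]
  change _ = (D.blockResolvent (A : X →L[ℂ] X) i z * D.block B i i) ∘L _
  rw [h3]
  rfl

theorem block_resolvent_self (hz : z ∉ D.causalSpectrum A) (i : Fin n) :
    D.block (resolvent (A : X →L[ℂ] X) z) i i = D.blockResolvent (A : X →L[ℂ] X) i z := by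
  rw [block_resolvent hz, Finset.sum_eq_zero fun k hk => ?_, block_one_self, add_zero]
  · rfl
  · rw [resolvent_mem_causal hz k i (Finset.mem_Iio.1 hk), ContinuousLinearMap.comp_zero]

theorem block_resolvent_succ (hz : z ∉ D.causalSpectrum A) {i j : Fin n}
    (hij : (i : ℕ) = j + 1) :
    D.block (resolvent (A : X →L[ℂ] X) z) i j = D.blockResolvent (A : X →L[ℂ] X) i z ∘L
      D.block (A : X →L[ℂ] X) i j ∘L D.blockResolvent (A : X →L[ℂ] X) j z := by
  have hji : j < i := Fin.lt_def.2 (by omega)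
  rw [block_resolvent hz, Finset.sum_eq_single j (fun k hk hkj => ?_) (fun h => ?_),
    block_one_of_ne D hji.ne', zero_add, block_resolvent_self hz]
  · have := Finset.mem_Iio.1 hk
    rw [resolvent_mem_causal hz k j (by grind), ContinuousLinearMap.comp_zero]
  · exact absurd (Finset.mem_Iio.2 hji) h

theorem block_resolvent_succ_succ (hz : z ∉ D.causalSpectrum A) {i k j : Fin n}
    (hij : (i : ℕ) = j + 2) (hkj : (k : ℕ) = j + 1) :
    D.block (resolvent (A : X →L[ℂ] X) z) i j =
      D.blockResolvent (A : X →L[ℂ] X) i z ∘L D.block (A : X →L[ℂ] X) i j ∘L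
        D.blockResolvent (A : X →L[ℂ] X) j z +
      D.blockResolvent (A : X →L[ℂ] X) i z ∘L D.block (A : X →L[ℂ] X) i k ∘L
        D.blockResolvent (A : X →L[ℂ] X) k z ∘L D.block (A : X →L[ℂ] X) k j ∘L
          D.blockResolvent (A : X →L[ℂ] X) j z := by
  have hji : j < i := Fin.lt_def.2 (by omega)
  have hki : k < i := Fin.lt_def.2 (by omega)
  have hjk : j < k := Fin.lt_def.2 (by omega)
  rw [block_resolvent hz, Finset.sum_eq_add j k hjk.ne (fun l hl hlne => ?_) (fun h => ?_)
    (fun h => ?_), block_one_of_ne D hji.ne', zero_add, block_resolvent_self hz,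
    block_resolvent_succ hz hkj, ContinuousLinearMap.comp_add]
  · have := Finset.mem_Iio.1 hl
    rw [resolvent_mem_causal hz l j (by grind), ContinuousLinearMap.comp_zero]
  · exact absurd (Finset.mem_Iio.2 hji) h
  · exact absurd (Finset.mem_Iio.2 hki) h

end ClosedDirectSum

/-! ### Sums over decreasing chains -/

namespace Chain

/-- A chain from `i` to `j` is either trivial or a first step followed by a chain. -/
def equivSum {n : ℕ} (i j : Fin n) :
    Chain i j ≃ PLift (i = j) ⊕ Σ k : {k : Fin n // k < i}, Chain k.1 j where
  toFun
    | .single _ => .inl ⟨rfl⟩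
    | .cons h c => .inr ⟨⟨_, h⟩, c⟩
  invFun
    | .inl h => h.down ▸ Chain.single i
    | .inr p => .cons p.1.2 p.2
  left_inv c := by cases c <;> rfl
  right_inv s := by
    rcases s with ⟨h⟩ | p
    · obtain ⟨rfl⟩ := h
      rfl
    · rfl

variable {X : Type*} [NormedAddCommGroup X] [NormedSpace ℂ X] [CompleteSpace X] {n : ℕ}
  {D : ClosedDirectSum X n}

theorem sum_resolventProd (A : X →L[ℂ] X) (z : ℂ) (i j : Fin n) :
    ∑ c : Chain i j, c.resolventProd D A z = D.blockResolvent A i z ∘L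
      (D.block 1 i j + ∑ k ∈ Finset.Iio i, D.block A i k ∘L
        ∑ c : Chain k j, c.resolventProd D A z) := by
  have hIio (g : Fin n → (D.V j →L[ℂ] D.V i)) :
      ∑ k ∈ Finset.Iio i, g k = ∑ k : {k : Fin n // k < i}, g k :=
    Finset.sum_subtype _ (fun k => Finset.mem_Iio) g
  rw [← Equiv.sum_comp (equivSum i j).symm, Fintype.sum_sum_type, Fintype.sum_sigma, hIio,
    ContinuousLinearMap.comp_add, ContinuousLinearMap.comp_finsetSum]
  congr 1
  · by_cases hij : i = j
    · subst hij
      rw [Fintype.sum_subsingleton _ ⟨rfl⟩, D.block_one_self]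
      rfl
    · have : IsEmpty (PLift (i = j)) := ⟨fun h => hij h.down⟩
      rw [Fintype.sum_empty, D.block_one_of_ne hij, ContinuousLinearMap.comp_zero]
  · refine Finset.sum_congr rfl fun k _ => ?_
    rw [ContinuousLinearMap.comp_finsetSum, ContinuousLinearMap.comp_finsetSum]
    rfl

/-- The entries of a causal resolvent are the sums of the chain products: both families satisfy
the recursion of forward substitution. -/
theorem block_resolvent_eq_sum {A : D.causal} {z : ℂ} (hz : z ∉ D.causalSpectrum A)
    (i j : Fin n) : D.block (resolvent (A : X →L[ℂ] X) z) i j =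
      ∑ c : Chain i j, c.resolventProd D (A : X →L[ℂ] X) z := by
  induction i using WellFoundedLT.induction with
  | ind i ih =>
    rw [ClosedDirectSum.block_resolvent hz, sum_resolventProd]
    congr 2
    exact Finset.sum_congr rfl fun k hk => by rw [ih k (Finset.mem_Iio.1 hk)]

end Chain

/-! ### Continuity of resolvents -/

theorem differentiableOn_resolvent {B : Type*} [NormedRing B] [NormedAlgebra ℂ B] [CompleteSpace B]
    (a : B) : DifferentiableOn ℂ (resolvent a) (resolventSet ℂ a) := fun _ hz =>
  (spectrum.hasDerivAt_resolvent_const_left hz).differentiableAt.differentiableWithinAt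

theorem ContinuousOn.clm_comp_const_comp {W X Y Z : Type*} [NormedAddCommGroup W] [NormedSpace ℂ W]
    [NormedAddCommGroup X] [NormedSpace ℂ X] [NormedAddCommGroup Y] [NormedSpace ℂ Y]
    [NormedAddCommGroup Z] [NormedSpace ℂ Z] {s : Set ℂ} {a : ℂ → Y →L[ℂ] Z} {b : ℂ → W →L[ℂ] X}
    (ha : ContinuousOn a s) (L : X →L[ℂ] Y) (hb : ContinuousOn b s) :
    ContinuousOn (fun z => a z ∘L L ∘L b z) s :=
  ha.clm_comp (continuousOn_const.clm_comp hb)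

theorem Contour.integral_clm_comp_comp {W X Y : Type*} [NormedAddCommGroup W] [NormedSpace ℂ W]
    [NormedAddCommGroup X] [NormedSpace ℂ X] [CompleteSpace X] [NormedAddCommGroup Y]
    [NormedSpace ℂ Y] [CompleteSpace Y] (Γ : Contour) (P : X →L[ℂ] Y) (J : W →L[ℂ] X)
    {g : ℂ → X →L[ℂ] X} (hg : ContinuousOn g Γ.support) :
    Γ.integral (fun z => P ∘L g z ∘L J) = P ∘L Γ.integral g ∘L J :=
  Γ.integral_clm ((ContinuousLinearMap.compL ℂ W X Y P) ∘L
    ((ContinuousLinearMap.compL ℂ W X X).flip J)) hg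

theorem Chain.continuousOn_resolventProd {X : Type*} [NormedAddCommGroup X] [NormedSpace ℂ X]
    [CompleteSpace X] {n : ℕ} (D : ClosedDirectSum X n) (A : X →L[ℂ] X) {s : Set ℂ}
    (hs : ∀ i, s ⊆ resolventSet ℂ (D.block A i i)) {i j : Fin n} (c : Chain i j) :
    ContinuousOn (fun z => c.resolventProd D A z) s := by
  have hr (i : Fin n) : ContinuousOn (fun z => D.blockResolvent A i z) s :=
    (differentiableOn_resolvent (B := D.V i →L[ℂ] D.V i) (D.block A i i)).continuousOn.mono (hs i)
  induction c with
  | single i => exact hr i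
  | @cons i k j h c ih =>
    simp only [resolventProd]
    exact ContinuousOn.clm_comp_const_comp (W := D.V j) (X := D.V k) (Y := D.V i) (Z := D.V i)
      (a := fun z => D.blockResolvent A i z) (b := fun z => c.resolventProd D A z)
      (hr i) (D.block A i k) ih

/-! ### The analytic functional calculus -/

namespace Contour

theorem Surrounds.mono {Γ : Contour} {K K' U : Set ℂ} (h : Γ.Surrounds K U) (hK : K' ⊆ K) :
    Γ.Surrounds K' U :=
  ⟨h.support_subset.trans (Set.sdiff_subset_sdiff_right hK), fun w hw => h.index_eq_one w (hK hw),
    h.index_eq_zero⟩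

variable {B : Type*} [NormedRing B] [NormedAlgebra ℂ B] [CompleteSpace B]

theorem differentiableOn_smul_resolvent {U : Set ℂ} {f : ℂ → ℂ} (hf : DifferentiableOn ℂ f U)
    (a : B) : DifferentiableOn ℂ (fun z => f z • resolvent a z) (U \ spectrum ℂ a) :=
  (hf.mono Set.sdiff_subset).smul
    ((differentiableOn_resolvent a).mono fun _ hz => not_not.1 hz.2)

/-- The value of `analyticFun` does not depend on the choice of the contour. -/
theorem Surrounds.analyticFun_eq {U : Set ℂ} (hU : IsOpen U) {f : ℂ → ℂ}
    (hf : DifferentiableOn ℂ f U) {a : B} {Γ : Contour} (hΓ : Γ.Surrounds (spectrum ℂ a) U) :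
    analyticFun U f a = Γ.normIntegral fun z => f z • resolvent a z := by
  have h : ∃ Γ : Contour, Γ.Surrounds (spectrum ℂ a) U := ⟨Γ, hΓ⟩
  have h0 := h.choose_spec
  rw [analyticFun, dif_pos h, normIntegral, normIntegral]
  congr 1
  refine integral_eq_of_index_sub_eq (c := 0) (hU.sdiff (spectrum.isClosed (𝕜 := ℂ) a))
    h0.support_subset hΓ.support_subset (fun w hw => ?_) (differentiableOn_smul_resolvent hf a)
    (by simp)
  by_cases hwU : w ∈ U
  · have hwa : w ∈ spectrum ℂ a := by
      by_contra h'
      exact hw ⟨hwU, h'⟩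
    rw [h0.index_eq_one w hwa, hΓ.index_eq_one w hwa, sub_self]
  · rw [h0.index_eq_zero w hwU, hΓ.index_eq_zero w hwU, sub_self]

/-- The contour without arcs. -/
def empty : Contour where
  n := 0
  src := Fin.elim0
  tgt := Fin.elim0
  arc k := k.elim0
  contDiffOn k := k.elim0
  closed := rfl

theorem integral_empty {F : Type*} [NormedAddCommGroup F] [NormedSpace ℂ F] (g : ℂ → F) :
    empty.integral g = 0 :=
  Finset.sum_of_isEmpty (ι := Fin 0) _

end Contour

namespace ClosedDirectSum

open Contour Filter Topology

variable {X : Type*} [NormedAddCommGroup X] [NormedSpace ℂ X] [CompleteSpace X] {n : ℕ}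

theorem block_normIntegral (D : ClosedDirectSum X n) (Γ : Contour) {g : ℂ → X →L[ℂ] X}
    (hg : ContinuousOn g Γ.support) (i j : Fin n) :
    D.block (Γ.normIntegral g) i j = Γ.normIntegral fun z => D.block (g z) i j := by
  rw [normIntegral, normIntegral, block_smul]
  congr 1
  exact (Γ.integral_clm_comp_comp (D.component i) (D.V j).subtypeL hg).symm

/-- A contour around `σ(A)` may meet the causal spectrum, so the resolvent on it need not be lower
triangular. But an entry of `f(z) (z - A)⁻¹` above the diagonal vanishes off the causal spectrum,
hence extends by zero from `U \ σ(A)` to a holomorphic function on the complement of `σ(A)` that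
vanishes near infinity, and Cauchy's theorem applies to it. -/
theorem block_analyticFun_eq_zero (D : ClosedDirectSum X n) (A : D.causal) {U : Set ℂ}
    (hU : IsOpen U) (hAU : D.causalSpectrum A ⊆ U) {f : ℂ → ℂ} (hf : DifferentiableOn ℂ f U)
    {i j : Fin n} (hij : i < j) : D.block (analyticFun U f (A : X →L[ℂ] X)) i j = 0 := by
  classical
  by_cases hex : ∃ Γ : Contour, Γ.Surrounds (spectrum ℂ (A : X →L[ℂ] X)) U
  swap
  -- without a contour around `σ(A)` the value of `analyticFun` is zero by definition
  · rw [analyticFun, dif_neg hex, block_zero]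
  obtain ⟨Γ, hΓ⟩ := hex
  have hd := differentiableOn_smul_resolvent hf (A : X →L[ℂ] X)
  rw [hΓ.analyticFun_eq hU hf, D.block_normIntegral Γ (hd.continuousOn.mono hΓ.support_subset)]
  set g : ℂ → (D.V j →L[ℂ] D.V i) := fun z => D.block (f z • resolvent (A : X →L[ℂ] X) z) i j
    with hg
  set h : ℂ → (D.V j →L[ℂ] D.V i) := fun z => if z ∈ U then g z else 0 with hh
  have hg0 {z : ℂ} (hz : z ∉ D.causalSpectrum A) : g z = 0 := by
    simp only [hg, block_smul, resolvent_mem_causal hz i j hij]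
    exact smul_zero (A := D.V j →L[ℂ] D.V i) (f z)
  have hh0 {z : ℂ} (hz : z ∉ D.causalSpectrum A) : h z = 0 := by
    simp only [hh, hg0 hz, ite_self]
  have hcpt : IsCompact (D.causalSpectrum A) := spectrum.isCompact (𝕜 := ℂ) A
  have hgh : Set.EqOn g h Γ.support := fun z hz => (if_pos (hΓ.support_subset hz).1).symm
  have hdh : DifferentiableOn ℂ h (spectrum ℂ (A : X →L[ℂ] X))ᶜ := by
    intro z hz
    refine DifferentiableAt.differentiableWithinAt ?_
    by_cases hzU : z ∈ U
    · have hdg : DifferentiableAt ℂ g z := D.differentiableAt_block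
        (hd.differentiableAt ((hU.sdiff (spectrum.isClosed (𝕜 := ℂ) _)).mem_nhds ⟨hzU, hz⟩)) i j
      refine hdg.congr_of_eventuallyEq ?_
      filter_upwards [hU.mem_nhds hzU] with y hy using if_pos hy
    · refine (differentiableAt_const (0 : D.V j →L[ℂ] D.V i)).congr_of_eventuallyEq ?_
      filter_upwards [hcpt.isClosed.isOpen_compl.mem_nhds fun h => hzU (hAU h)] with y hy
        using hh0 hy
  have key := integral_eq_of_index_sub_eq (h := h) (Γ := Γ) (Γ' := Contour.empty) (c := 1)
    (spectrum.isClosed (𝕜 := ℂ) (A : X →L[ℂ] X)).isOpen_compl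
    (hΓ.support_subset.trans fun z hz => hz.2) (by simp [support, Contour.empty])
    (fun w hw => by
      rw [hΓ.index_eq_one w (not_not.1 hw)]
      simp [index, normIntegral, integral_empty]) hdh (by
      filter_upwards [hcpt.compl_mem_cocompact] with z hz
      rw [hh0 hz]
      exact smul_zero (A := D.V j →L[ℂ] D.V i) 1)
  rw [normIntegral, Γ.integral_congr hgh, key, integral_empty]
  exact smul_zero (A := D.V j →L[ℂ] D.V i) _

/-- The entries of `f(A)` as contour integrals of the entries of the resolvent. -/
theorem block_analyticFun (D : ClosedDirectSum X n) (A : D.causal) {U : Set ℂ} (hU : IsOpen U)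
    {f : ℂ → ℂ} (hf : DifferentiableOn ℂ f U) {Γ : Contour}
    (hΓ : Γ.Surrounds (D.causalSpectrum A) U) (i j : Fin n) {g : ℂ → (D.V j →L[ℂ] D.V i)}
    (hg : ∀ z, z ∉ D.causalSpectrum A → D.block (resolvent (A : X →L[ℂ] X) z) i j = g z) :
    D.block (analyticFun U f (A : X →L[ℂ] X)) i j = Γ.normIntegral fun z => f z • g z := by
  have hΓ' := hΓ.mono (D.spectrum_subset_causalSpectrum A)
  rw [hΓ'.analyticFun_eq hU hf, D.block_normIntegral Γ
    ((differentiableOn_smul_resolvent hf _).continuousOn.mono hΓ'.support_subset),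
    normIntegral, normIntegral]
  congr 1
  refine Γ.integral_congr fun z hz => ?_
  simp only [block_smul, hg z (hΓ.support_subset hz).2]

end ClosedDirectSum

end

/-! ### Entries of `f(A)` -/

theorem theoremt {X : Type*} [NormedAddCommGroup X] [NormedSpace ℂ X] [CompleteSpace X]
    {n : ℕ} (D : ClosedDirectSum X n) (A : D.causal)
    (U : Set ℂ) (hU : IsOpen U) (hAU : D.causalSpectrum A ⊆ U)
    (f : ℂ → ℂ) (hf : AnalyticOnNhd ℂ f U) :
    (∀ i j, i < j → D.block (analyticFun U f (A : X →L[ℂ] X)) i j = 0) ∧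
    ∀ Γ : Contour, Γ.Surrounds (D.causalSpectrum A) U →
      (∀ z ∈ Γ.support, ∀ i, z ∈ resolventSet ℂ (D.block (A : X →L[ℂ] X) i i)) ∧
      (∀ i j, j ≤ i →
        (∀ c : Chain i j, Γ.Integrable fun z => f z • c.resolventProd D (A : X →L[ℂ] X) z) ∧
        D.block (analyticFun U f (A : X →L[ℂ] X)) i j =
          ∑ c : Chain i j, Γ.normIntegral fun z => f z • c.resolventProd D (A : X →L[ℂ] X) z) ∧
      (∀ i, D.block (analyticFun U f (A : X →L[ℂ] X)) i i =
          Γ.normIntegral fun z => f z • D.blockResolvent (A : X →L[ℂ] X) i z) ∧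
      (∀ i j : Fin n, (i : ℕ) = j + 1 →
        D.block (analyticFun U f (A : X →L[ℂ] X)) i j =
          Γ.normIntegral fun z => f z •
            (D.blockResolvent (A : X →L[ℂ] X) i z ∘L D.block (A : X →L[ℂ] X) i j ∘L
              D.blockResolvent (A : X →L[ℂ] X) j z)) ∧
      (∀ i k j : Fin n, (i : ℕ) = j + 2 → (k : ℕ) = j + 1 →
        D.block (analyticFun U f (A : X →L[ℂ] X)) i j =
          (Γ.normIntegral fun z => f z •
            (D.blockResolvent (A : X →L[ℂ] X) i z ∘L D.block (A : X →L[ℂ] X) i j ∘L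
              D.blockResolvent (A : X →L[ℂ] X) j z)) +
          Γ.normIntegral fun z => f z •
            (D.blockResolvent (A : X →L[ℂ] X) i z ∘L D.block (A : X →L[ℂ] X) i k ∘L
              D.blockResolvent (A : X →L[ℂ] X) k z ∘L D.block (A : X →L[ℂ] X) k j ∘L
                D.blockResolvent (A : X →L[ℂ] X) j z)) := by
  have hf' : DifferentiableOn ℂ f U := hf.differentiableOn
  refine ⟨fun i j hij => D.block_analyticFun_eq_zero A hU hAU hf' hij, fun Γ hΓ => ?_⟩
  have hz {z : ℂ} (h : z ∈ Γ.support) : z ∉ D.causalSpectrum A := (hΓ.support_subset h).2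
  have hfc : ContinuousOn f Γ.support :=
    hf'.continuousOn.mono fun z h => (hΓ.support_subset h).1
  have hres (z : ℂ) (h : z ∈ Γ.support) (i : Fin n) := ClosedDirectSum.mem_resolventSet_block (hz h) i
  have hcont {i j : Fin n} (c : Chain i j) :
      ContinuousOn (fun z => f z • c.resolventProd D (A : X →L[ℂ] X) z) Γ.support :=
    hfc.smul (c.continuousOn_resolventProd D _ fun i z h => hres z h i)
  have hr (i : Fin n) :
      ContinuousOn (fun z => D.blockResolvent (A : X →L[ℂ] X) i z) Γ.support :=
    (Chain.single i).continuousOn_resolventProd D _ fun i z h => hres z h i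
  refine ⟨hres, fun i j _ => ⟨fun c => Γ.integrable_of_continuousOn (hcont c), ?_⟩, fun i => ?_,
    fun i j hij => ?_, fun i k j hij hkj => ?_⟩
  · rw [D.block_analyticFun A hU hf' hΓ i j fun z h => Chain.block_resolvent_eq_sum h i j]
    simp only [Contour.normIntegral, Finset.smul_sum]
    rw [Γ.integral_sum _ fun c _ => hcont c, Finset.smul_sum]
  · exact D.block_analyticFun A hU hf' hΓ i i fun z h => ClosedDirectSum.block_resolvent_self h i
  · exact D.block_analyticFun A hU hf' hΓ i j fun z h => ClosedDirectSum.block_resolvent_succ h hij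
  · rw [D.block_analyticFun A hU hf' hΓ i j fun z h => ClosedDirectSum.block_resolvent_succ_succ h hij hkj]
    simp only [Contour.normIntegral, smul_add]
    rw [Γ.integral_add, smul_add]
    · exact hfc.smul ((hr i).clm_comp_const_comp _ (hr j))
    · exact hfc.smul ((hr i).clm_comp_const_comp _ ((hr k).clm_comp_const_comp _ (hr j)))
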